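/- For $\phi\in C_c^\infty(\mathbb{R}^\times)$ and a function $f$ on $\mathbb{R}^\times$ put $(\phi\star f)(y)=\int_{\mathbb{R}^\times}\phi(x)f(x^{-1}y)\,d^\times x$, where $d^\times x=dx/|x|$. For $s\in\mathbb{C}$ and a unitary character $\chi$ of $\mathbb{R}^\times$, the Mellin transform of $g$ at $|x|^s\chi(x)$ is $\mathcal{M}(g,s,\chi)=\int_{\mathbb{R}^\times}g(x)|x|^s\chi(x)\,d^\times x$; it is well defined if this integral converges absolutely. A number $M$ is a weak Mellin transform of $f$ at $|x|^s\chi(x)$ if for every $\phi\in C_c^\infty(\mathbb{R}^\times)$ the convolution $\phi\star f$ is well defined (its integral converges absolutely for every $y\in\mathbb{R}^\times$), its Mellin transform at $|x|^s\chi(x)$ is well defined, and $\mathcal{M}(\phi\star f,s,\chi)=M\,\mathcal{M}(\phi,s,\chi)$. Let ${}_1F_1(u,v,z)=\sum_{k\ge0}\frac{(u)_k}{(v)_k}\frac{z^k}{k!}$, where $(u)_k=u(u+1)\cdots(u+k-1)$. Let $a>0$, $b\in\mathbb{R}$, let $s\in\mathbb{C}$ with $\Re(s)>0$, and let $f(x)=e^{-2\pi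 i\left(\frac a2x^2+bx\right)}$. Then: 1. $f$ has exactly one weak Mellin transform at the character $|x|^s$, namely $$\frac{e^{-s\frac{\pi i}4}}{\sqrt a^{\,s}}\,\frac{\Gamma(\frac s2)}{\pi^{\frac s2}}\;{}_1F_1\!\left(\frac s2,\frac12,\frac{\pi i b^2}{a}\right).$$ 2. $f$ has exactly one weak Mellin transform at the character $\operatorname{sign}(x)|x|^s$, namely $$-2\pi i b\,\frac{e^{-(s+1)\frac{\pi i}4}}{\sqrt a^{\,s+1}}\,\frac{\Gamma(\frac{s+1}2)}{\pi^{\frac{s+1}2}}\;{}_1F_1\!\left(\frac{s+1}2,\frac32,\frac{\pi i b^2}{a}\right).$$ -/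

import Mathlib

open scoped ContDiff

noncomputable section

namespace WeakMellin

/-- The standard additive character `ψ(x) = e^{-2πix}` of `ℝ`. -/
def psi (x : ℝ) : ℂ := Complex.exp (-2 * Real.pi * Complex.I * x)

/-- The function `x ↦ ψ((a/2) x² + b x)`. -/
def secondDegreeChar (a b : ℝ) (x : ℝ) : ℂ := psi (a / 2 * x ^ 2 + b * x)

/-- The space `C_c^∞(ℝ^×)` of smooth complex functions on `ℝ^×` with compact support in `ℝ^×`,
each such function being extended by `0` to `ℝ`. -/
structure IsTestFunction (φ : ℝ → ℂ) : Prop where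
  smooth : ContDiff ℝ ∞ φ
  compactSupport : HasCompactSupport φ
  zero_notMem : (0 : ℝ) ∉ tsupport φ

/-- The integral of `g` over `ℝ^×` against the Haar measure `d^×x = dx / |x|` converges
absolutely. (The point `0` is a null set.) -/
def MulIntegrable (g : ℝ → ℂ) : Prop :=
  MeasureTheory.Integrable (fun x : ℝ => g x / ((|x| : ℝ) : ℂ))

/-- The integral of `g` over `ℝ^×` against the Haar measure `d^×x = dx / |x|`. -/
def mulIntegral (g : ℝ → ℂ) : ℂ := ∫ x : ℝ, g x / ((|x| : ℝ) : ℂ)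

/-- The multiplicative convolution `(φ ⋆ f)(y) = ∫_{ℝ^×} φ(x) f(x⁻¹y) d^×x`. -/
def mulConv (φ f : ℝ → ℂ) (y : ℝ) : ℂ := mulIntegral (fun x => φ x * f (x⁻¹ * y))

/-- `φ ⋆ f` is well defined on `ℝ^×`. -/
def MulConvExists (φ f : ℝ → ℂ) : Prop :=
  ∀ y : ℝ, y ≠ 0 → MulIntegrable (fun x => φ x * f (x⁻¹ * y))

/-- The Mellin transform (over all of `ℝ^×`) of `f` at the character `|x|^s χ(x)` is well
defined, that is, its integral converges absolutely. -/
def MellinExists (f : ℝ → ℂ) (s : ℂ) (χ : ℝ → ℂ) : Prop :=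
  MulIntegrable (fun x => f x * ((|x| : ℝ) : ℂ) ^ s * χ x)

/-- The Mellin transform `∫_{ℝ^×} f(x) |x|^s χ(x) d^×x`. -/
def mellinReal (f : ℝ → ℂ) (s : ℂ) (χ : ℝ → ℂ) : ℂ :=
  mulIntegral (fun x => f x * ((|x| : ℝ) : ℂ) ^ s * χ x)

/-- The number `M` is a weak Mellin transform of `f` at the character `|x|^s χ(x)`: for every
`φ ∈ C_c^∞(ℝ^×)` the convolution `φ ⋆ f` is well defined, its Mellin transform at `|x|^s χ(x)`
is well defined, and it equals `M` times the Mellin transform of `φ`. -/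
def IsWeakMellin (f : ℝ → ℂ) (s : ℂ) (χ : ℝ → ℂ) (M : ℂ) : Prop :=
  ∀ φ : ℝ → ℂ, IsTestFunction φ →
    MulConvExists φ f ∧ MellinExists (mulConv φ f) s χ ∧
      mellinReal (mulConv φ f) s χ = M * mellinReal φ s χ

/-- The trivial character of `ℝ^×`. -/
def trivialChar (_ : ℝ) : ℂ := 1

/-- The sign character of `ℝ^×`. -/
def signChar (x : ℝ) : ℂ := ((Real.sign x : ℝ) : ℂ)

/-- Kummer's function `₁F₁(u, v, z) = ∑ (u)_k / (v)_k * z^k / k!`, where `(u)_k` is the rising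
factorial. The series converges for all `z` when `v` is not one of `0, -1, -2, …`. -/
def oneFOne (u v z : ℂ) : ℂ :=
  ∑' k : ℕ, (ascPochhammer ℂ k).eval u / ((ascPochhammer ℂ k).eval v * (k.factorial : ℂ)) * z ^ k

end WeakMellin

end

/-!
The function `f(x) = e^{-πia x² - 2πib x}` is the boundary value at `c = πia` of the functions
`F_c(t) = e^{-c t² - iβ t}`, `β = 2πb`, which decay rapidly when `Re c > 0` (`gaussChar`).

For `Re c > 0` everything converges absolutely. Fubini gives
`𝓜(φ ⋆ F_c) = 𝓜(F_c) 𝓜(φ)` (`mellinReal_mulConv_gaussChar`), and folding the real line at `0` leaves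
`2 cos(βt)` for the trivial character and `-2i sin(βt)` for the sign character. Expanding these in
power series and integrating termwise against `t^{s-1} e^{-ct²}` produces Gamma values
`Γ(s/2 + k) = (s/2)_k Γ(s/2)`, hence Kummer's function at `-β²/(4c)`
(`mellinReal_gaussChar_trivialChar`, `mellinReal_gaussChar_signChar`). The moments of the Gaussian
with complex `c` come from the real case by the identity theorem.

To reach `c₀ = πia`, let `c = c₀ + ε` with `ε → 0⁺`. The closed forms are continuous there. On the
side of the convolutions, integration by parts in
`J(φ)(y) = ∫ φ(x) F_c(y/x) dx` gives `2cy² J(φ) = -J((x³φ)') - iβy J(xφ)`, where both new functions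
are again test functions; iterating, `J(φ)(y)` is `O((1 + |y|)^{-n})` for every `n`, uniformly for
`Re c ≥ 0` and `|c| ≥ |c₀|` (`exists_norm_integral_mul_gaussChar_le`). Dominated convergence then
carries the product formula to the limit (`isWeakMellin_gaussChar_of_tendsto`). Near `y = 0` the
integrals converge because `Re s > 0`.

Uniqueness holds because some test function has a nonzero Mellin transform
(`exists_isTestFunction_mellinReal_ne_zero`).
-/

namespace WeakMellin

open MeasureTheory Set Filter Topology

/-! ### Gaussian moments with a complex parameter -/

/-- Euler's integral with a complex rate `r` in the right half plane. Both sides are holomorphic in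
`r`, and for real `r` the formula is a rescaling, so the identity theorem applies. -/
theorem integral_cpow_mul_exp_neg_mul_Ioi_of_re_pos {a r : ℂ} (ha : 0 < a.re) (hr : 0 < r.re) :
    ∫ t : ℝ in Ioi 0, (t : ℂ) ^ (a - 1) * Complex.exp (-(r * t)) = (1 / r) ^ a * Complex.Gamma a := by
  set U : Set ℂ := {z | 0 < z.re} with hU
  have hUo : IsOpen U := isOpen_lt continuous_const Complex.continuous_re
  have hnorm : ∀ (z : ℂ) (t : ℝ), 0 < t →
      ‖(t : ℂ) ^ (a - 1) * Complex.exp (-(z * t))‖ = t ^ (a.re - 1) * Real.exp (-(z.re * t)) := by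
    intro z t ht
    rw [norm_mul, Complex.norm_cpow_eq_rpow_re_of_pos ht, Complex.norm_exp]
    simp
  have hint : ∀ (p b : ℝ), -1 < p → 0 < b →
      IntegrableOn (fun t : ℝ => t ^ p * Real.exp (-(b * t))) (Ioi 0) := by
    intro p b hp hb
    have := integrableOn_rpow_mul_exp_neg_mul_rpow (p := 1) (s := p) (b := b) hp one_pos hb
    simpa [Real.rpow_one, neg_mul] using this
  have hmeas : ∀ (z : ℂ), AEStronglyMeasurable
      (fun t : ℝ => (t : ℂ) ^ (a - 1) * Complex.exp (-(z * t))) (volume.restrict (Ioi 0)) := by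
    intro z
    exact Measurable.aestronglyMeasurable (by fun_prop)
  have hd : DifferentiableOn ℂ
      (fun z : ℂ => ∫ t : ℝ in Ioi 0, (t : ℂ) ^ (a - 1) * Complex.exp (-(z * t))) U := by
    intro z hz
    have hz0 : 0 < z.re := hz
    have hs : {w : ℂ | z.re / 2 < w.re} ∈ 𝓝 z :=
      (isOpen_lt continuous_const Complex.continuous_re).mem_nhds (by simp; linarith)
    -- On `Re w > Re z / 2` the derivative is dominated by `t ^ Re a * e^{-(Re z / 2) t}`.
    refine (hasDerivAt_integral_of_dominated_loc_of_deriv_le (μ := volume.restrict (Ioi (0:ℝ)))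
      (F := fun (z : ℂ) (t : ℝ) => (t : ℂ) ^ (a - 1) * Complex.exp (-(z * t)))
      (F' := fun (z : ℂ) (t : ℝ) => (t : ℂ) ^ (a - 1) * Complex.exp (-(z * t)) * (-t))
      (bound := fun t => t ^ a.re * Real.exp (-(z.re / 2 * t)))
      hs (Eventually.of_forall hmeas) ?_ ?_ ?_ ?_ ?_).2.differentiableAt.differentiableWithinAt
    · refine (hint (a.re - 1) z.re (by linarith) hz0).mono' (hmeas z) ?_
      filter_upwards [ae_restrict_mem measurableSet_Ioi] with t ht
      exact (hnorm z t ht).le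
    · exact Measurable.aestronglyMeasurable (by fun_prop)
    · filter_upwards [ae_restrict_mem measurableSet_Ioi] with t ht w hw
      have ht0 : 0 < t := ht
      have hw' : z.re / 2 < w.re := hw
      rw [norm_mul, hnorm w t ht, norm_neg, Complex.norm_real, Real.norm_of_nonneg ht0.le]
      have : t ^ a.re = t ^ (a.re - 1) * t := by
        rw [Real.rpow_sub_one ht0.ne']; field_simp
      rw [this, mul_right_comm]
      gcongr
    · exact hint a.re (z.re / 2) (by linarith) (by linarith)
    · refine Eventually.of_forall fun t w _ => ?_
      have h1 : HasDerivAt (fun w : ℂ => -(w * (t : ℂ))) (-(1 * (t : ℂ))) w :=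
        ((hasDerivAt_id w).mul_const _).neg
      convert! (h1.cexp.const_mul ((t : ℂ) ^ (a - 1))) using 1
      ring
  have hslit : ∀ z ∈ U, 1 / z ∈ Complex.slitPlane := by
    intro z hz
    left
    have hz0 : 0 < z.re := hz
    rw [one_div, Complex.inv_re]
    exact div_pos hz0 (Complex.normSq_pos.2 (by rintro rfl; simp at hz0))
  have hd2 : DifferentiableOn ℂ (fun z : ℂ => (1 / z) ^ a * Complex.Gamma a) U := by
    intro z hz
    have hz0 : z ≠ 0 := by rintro rfl; simp [hU] at hz
    refine DifferentiableAt.differentiableWithinAt ?_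
    refine DifferentiableAt.mul_const ?_ _
    exact (DifferentiableAt.div (by fun_prop) differentiableAt_id hz0).cpow_const (hslit z hz)
  have key := (hd.analyticOnNhd hUo).eqOn_of_preconnected_of_frequently_eq (hd2.analyticOnNhd hUo)
    (convex_halfSpace_re_gt 0).isPreconnected (z₀ := 1) (by simp [hU]) ?_
  · exact key hr
  · -- The two sides agree at the real points `1 + 1 / (n + 1)`, which accumulate at `1`.
    have ht : Tendsto (fun n : ℕ => (1 : ℂ) + ((1 / ((n : ℝ) + 1) : ℝ) : ℂ)) atTop (𝓝[≠] 1) := by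
      refine tendsto_nhdsWithin_iff.2 ⟨?_, Eventually.of_forall fun n => ?_⟩
      · have h0 := (Complex.continuous_ofReal.tendsto 0).comp
          (tendsto_one_div_add_atTop_nhds_zero_nat (𝕜 := ℝ))
        simpa using h0.const_add (1 : ℂ)
      · have : (1 / ((n : ℝ) + 1) : ℝ) ≠ 0 := by positivity
        simpa only [mem_compl_iff, mem_singleton_iff, add_eq_left, Complex.ofReal_eq_zero] using this
    refine ht.frequently (Frequently.of_forall fun n => ?_)
    have hpos : 0 < 1 + 1 / ((n : ℝ) + 1) := by positivity
    have := Complex.integral_cpow_mul_exp_neg_mul_Ioi ha hpos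
    push_cast at this ⊢
    exact this

/-- The Mellin transform of a Gaussian on the half line, for a complex width. -/
theorem integral_cpow_mul_exp_neg_mul_sq_Ioi {u c : ℂ} (hu : 0 < u.re) (hc : 0 < c.re) :
    ∫ t : ℝ in Ioi 0, (t : ℂ) ^ (u - 1) * Complex.exp (-(c * (t : ℂ) ^ 2))
      = 1 / 2 * (Complex.Gamma (u / 2) * (1 / c) ^ (u / 2)) := by
  have h := integral_cpow_mul_exp_neg_mul_Ioi_of_re_pos (a := u / 2) (r := c)
    (by simpa using hu) hc
  rw [← integral_comp_rpow_Ioi_of_pos (p := 2) two_pos] at h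
  rw [mul_comm (Complex.Gamma _), ← h, ← integral_const_mul]
  refine setIntegral_congr_fun measurableSet_Ioi fun t ht => ?_
  have ht0 : 0 < t := ht
  have htc : (t : ℂ) ≠ 0 := by exact_mod_cast ht0.ne'
  have h2 : (((t ^ (2 : ℝ) : ℝ) : ℂ)) ^ (u / 2 - 1) = (t : ℂ) ^ (u - 2) := by
    rw [Real.rpow_two, sq, Complex.ofReal_mul, Complex.mul_cpow_ofReal_nonneg ht0.le ht0.le,
      ← Complex.cpow_add _ _ htc]
    congr 1
    ring
  have h3 : (t : ℂ) ^ (u - 1) = t * (t : ℂ) ^ (u - 2) := by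
    rw [show u - 1 = 1 + (u - 2) by ring, Complex.cpow_add _ _ htc, Complex.cpow_one]
  have h4 : ((2 : ℝ) - 1) = 1 := by norm_num
  simp only [h4, Real.rpow_one, Complex.real_smul, h2, h3]
  rw [Real.rpow_two]
  push_cast
  ring

/-! ### Kummer's function -/

theorem ascPochhammer_eval_ne_zero {u : ℂ} (hu : 0 < u.re) (k : ℕ) :
    (ascPochhammer ℂ k).eval u ≠ 0 := by
  induction k with
  | zero => simp
  | succ k ih =>
    rw [ascPochhammer_succ_eval]
    refine mul_ne_zero ih fun h => ?_
    have := congrArg Complex.re h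
    simp at this
    have hk : (0 : ℝ) ≤ k := k.cast_nonneg
    linarith

/-- The ratio of consecutive terms is `(u + k) / (v + k) * z / (k + 1)`, which tends to `0`. -/
theorem summable_oneFOne {u v z : ℂ} (hu : 0 < u.re) (hv : 0 < v.re) :
    Summable fun k : ℕ => (ascPochhammer ℂ k).eval u /
      ((ascPochhammer ℂ k).eval v * (k.factorial : ℂ)) * z ^ k := by
  rcases eq_or_ne z 0 with rfl | hz
  · refine summable_of_ne_finset_zero (s := {0}) fun k hk => ?_
    simp [Finset.mem_singleton.not.1 hk]
  have hne : ∀ k : ℕ, (ascPochhammer ℂ k).eval u /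
      ((ascPochhammer ℂ k).eval v * (k.factorial : ℂ)) * z ^ k ≠ 0 := fun k =>
    mul_ne_zero (div_ne_zero (ascPochhammer_eval_ne_zero hu k)
      (mul_ne_zero (ascPochhammer_eval_ne_zero hv k) (by exact_mod_cast k.factorial_ne_zero)))
      (pow_ne_zero _ hz)
  refine summable_of_ratio_test_tendsto_lt_one zero_lt_one (Eventually.of_forall hne) ?_
  have hadd : ∀ w : ℂ, 0 < w.re → ∀ k : ℕ, w + k ≠ 0 := by
    intro w hw k h
    have := congrArg Complex.re h
    simp at this
    have hk : (0 : ℝ) ≤ k := k.cast_nonneg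
    linarith
  have hlim : Tendsto (fun k : ℕ => ‖(1 + (u - v) / (v + k)) * (z / ((k : ℂ) + 1))‖) atTop (𝓝 0) := by
    have hinv : ∀ w : ℂ, Tendsto (fun k : ℕ => (w + (k : ℂ))⁻¹) atTop (𝓝 0) := fun w =>
      tendsto_inv₀_cobounded.comp ((tendsto_const_add_cobounded w).comp
        (tendsto_natCast_atTop_cobounded (α := ℂ)))
    have h1 : Tendsto (fun k : ℕ => 1 + (u - v) / (v + (k : ℂ))) atTop (𝓝 1) := by
      simpa [div_eq_mul_inv] using ((hinv v).const_mul (u - v)).const_add 1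
    have h2 : Tendsto (fun k : ℕ => z / ((k : ℂ) + 1)) atTop (𝓝 0) := by
      simpa [div_eq_mul_inv, add_comm] using (hinv 1).const_mul z
    simpa using (h1.mul h2).norm
  refine hlim.congr fun k => ?_
  rw [← norm_div]
  congr 1
  have e1 := ascPochhammer_eval_ne_zero hu k
  have e2 := ascPochhammer_eval_ne_zero hv k
  have e3 := hadd v hv k
  have e4 : (k : ℂ) + 1 ≠ 0 := by exact_mod_cast k.succ_ne_zero
  have e5 : ((k.factorial : ℕ) : ℂ) ≠ 0 := by exact_mod_cast k.factorial_ne_zero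
  rw [ascPochhammer_succ_eval, ascPochhammer_succ_eval, Nat.factorial_succ]
  push_cast
  field_simp
  ring

theorem continuous_oneFOne {u v : ℂ} (hu : 0 < u.re) (hv : 0 < v.re) :
    Continuous (oneFOne u v) := by
  refine continuous_iff_continuousAt.2 fun z => ?_
  have hmem : Metric.closedBall (0 : ℂ) (‖z‖ + 1) ∈ 𝓝 z :=
    mem_of_superset (Metric.isOpen_ball.mem_nhds (by simp)) Metric.ball_subset_closedBall
  refine ContinuousOn.continuousAt (s := Metric.closedBall (0 : ℂ) (‖z‖ + 1)) ?_ hmem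
  refine continuousOn_tsum (fun k => by fun_prop)
    (summable_oneFOne (z := ((‖z‖ + 1 : ℝ) : ℂ)) hu hv).norm fun k w hw => ?_
  rw [norm_mul, norm_mul, norm_pow, norm_pow, Complex.norm_real,
    Real.norm_of_nonneg (by positivity)]
  have : ‖w‖ ≤ ‖z‖ + 1 := by simpa using hw
  gcongr

theorem ascPochhammer_half_mul_factorial (k : ℕ) :
    (4 : ℂ) ^ k * ((ascPochhammer ℂ k).eval (1 / 2) * (k.factorial : ℂ)) = ((2 * k).factorial : ℂ) := by
  induction k with
  | zero => simp
  | succ k ih =>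
    rw [show 2 * (k + 1) = 2 * k + 1 + 1 by ring, Nat.factorial_succ, Nat.factorial_succ,
      ascPochhammer_succ_eval, Nat.factorial_succ]
    push_cast
    rw [← ih]
    ring

theorem ascPochhammer_three_halves_mul_factorial (k : ℕ) :
    (4 : ℂ) ^ k * ((ascPochhammer ℂ k).eval (3 / 2) * (k.factorial : ℂ)) =
      ((2 * k + 1).factorial : ℂ) := by
  induction k with
  | zero => simp
  | succ k ih =>
    rw [show 2 * (k + 1) + 1 = 2 * k + 1 + 1 + 1 by ring, Nat.factorial_succ, Nat.factorial_succ,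
      ascPochhammer_succ_eval, Nat.factorial_succ]
    push_cast
    rw [← ih]
    ring

theorem Gamma_add_natCast {u : ℂ} (hu : 0 < u.re) (k : ℕ) :
    Complex.Gamma (u + k) = (ascPochhammer ℂ k).eval u * Complex.Gamma u := by
  rw [← Complex.Gamma_add_nat_div_Gamma_eq, div_mul_cancel₀ _ (Complex.Gamma_ne_zero_of_re_pos hu)]
  intro j h
  rw [h] at hu
  simp at hu
  have : (0 : ℝ) ≤ j := j.cast_nonneg
  linarith

/-! ### Termwise integration of trigonometric series against Gaussians -/

/-- Termwise integration of an even power series `h(t) = ∑ d_k t^{2k}`, of at most the growth of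
`cosh (R t)`, against `t^{u-1} e^{-ct²}`. -/
theorem hasSum_integral_gaussian_mul_even {u c : ℂ} (hu : 0 < u.re) (hc : 0 < c.re)
    {d : ℕ → ℂ} {B R : ℝ} (hd : ∀ k, ‖d k‖ ≤ B * (R ^ (2 * k) / (2 * k).factorial))
    {h : ℝ → ℂ} (hh : ∀ t : ℝ, 0 < t → HasSum (fun k => d k * (t : ℂ) ^ (2 * k)) (h t)) :
    HasSum (fun k : ℕ => d k * (1 / 2 * (Complex.Gamma (u / 2 + k) * (1 / c) ^ (u / 2 + k))))
      (∫ t : ℝ in Ioi 0, (t : ℂ) ^ (u - 1) * Complex.exp (-(c * (t : ℂ) ^ 2)) * h t) := by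
  have hnorm : ∀ t : ℝ, 0 < t → ‖(t : ℂ) ^ (u - 1) * Complex.exp (-(c * (t : ℂ) ^ 2))‖
      = t ^ (u.re - 1) * Real.exp (-c.re * t ^ 2) := by
    intro t ht
    rw [norm_mul, Complex.norm_cpow_eq_rpow_re_of_pos ht, Complex.norm_exp, ← Complex.ofReal_pow,
      Complex.neg_re, Complex.re_mul_ofReal, neg_mul, Complex.sub_re, Complex.one_re]
  have hterm : ∀ k : ℕ, ∫ t : ℝ in Ioi 0, (t : ℂ) ^ (u - 1) * Complex.exp (-(c * (t : ℂ) ^ 2)) *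
      (d k * (t : ℂ) ^ (2 * k)) =
      d k * (1 / 2 * (Complex.Gamma (u / 2 + k) * (1 / c) ^ (u / 2 + k))) := by
    intro k
    have hk : (0 : ℝ) ≤ k := k.cast_nonneg
    have := integral_cpow_mul_exp_neg_mul_sq_Ioi (u := u + 2 * k) (c := c)
      (by simp; linarith) hc
    rw [show (u + 2 * (k : ℂ)) / 2 = u / 2 + k by ring] at this
    rw [← this, ← integral_const_mul]
    refine setIntegral_congr_fun measurableSet_Ioi fun t ht => ?_
    have htc : (t : ℂ) ≠ 0 := by exact_mod_cast (ne_of_gt ht)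
    have : (t : ℂ) ^ (u + 2 * k - 1) = (t : ℂ) ^ (u - 1) * (t : ℂ) ^ (2 * k) := by
      rw [show u + 2 * k - 1 = (u - 1) + ((2 * k : ℕ) : ℂ) by push_cast; ring,
        Complex.cpow_add _ _ htc, Complex.cpow_natCast]
    simp only [this]
    ring
  simp_rw [← hterm]
  refine hasSum_integral_of_dominated_convergence
    (fun k t => t ^ (u.re - 1) * Real.exp (-c.re * t ^ 2) *
      (B * ((R * t) ^ (2 * k) / (2 * k).factorial))) (fun k => ?_) (fun k => ?_) ?_ ?_ ?_
  · exact Measurable.aestronglyMeasurable (by fun_prop)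
  · filter_upwards [ae_restrict_mem measurableSet_Ioi] with t ht
    have ht0 : 0 < t := ht
    rw [norm_mul, hnorm t ht, norm_mul, norm_pow, Complex.norm_real, Real.norm_of_nonneg ht0.le]
    have h1 := mul_le_mul_of_nonneg_right (hd k) (pow_nonneg ht0.le (2 * k))
    have h2 : B * ((R * t) ^ (2 * k) / (2 * k).factorial) =
        B * (R ^ (2 * k) / (2 * k).factorial) * t ^ (2 * k) := by
      rw [mul_pow]; ring
    rw [h2]
    exact mul_le_mul_of_nonneg_left h1 (by positivity)
  · exact Eventually.of_forall fun t => ((Real.hasSum_cosh (R * t)).summable.mul_left B).mul_left _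
  · have heq : (fun t : ℝ => ∑' k : ℕ, t ^ (u.re - 1) * Real.exp (-c.re * t ^ 2) *
        (B * ((R * t) ^ (2 * k) / (2 * k).factorial))) =
        fun t => B * (t ^ (u.re - 1) * Real.exp (-c.re * t ^ 2) * Real.cosh (R * t)) := by
      funext t
      rw [(((Real.hasSum_cosh (R * t)).mul_left B).mul_left _).tsum_eq]
      ring
    rw [heq]
    -- Completing the square, `|R t| ≤ R² / (2κ) + κ t² / 2` with `κ = c.re`.
    have hbase := (integrableOn_rpow_mul_exp_neg_mul_sq (b := c.re / 2) (by linarith)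
      (show -1 < u.re - 1 by linarith)).const_mul (Real.exp (R ^ 2 / (2 * c.re)))
    refine Integrable.const_mul (hbase.mono' (Measurable.aestronglyMeasurable
      (by fun_prop)) ?_) B
    filter_upwards [ae_restrict_mem measurableSet_Ioi] with t ht
    have ht0 : 0 < t := ht
    rw [Real.norm_of_nonneg (by positivity)]
    -- Both exponentials in `cosh (R t)` are covered by taking `x = ± R t`.
    have hsq : ∀ x : ℝ, x ^ 2 = (R * t) ^ 2 → Real.exp (-c.re * t ^ 2) * Real.exp x ≤
        Real.exp (R ^ 2 / (2 * c.re)) * Real.exp (-(c.re / 2) * t ^ 2) := by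
      intro x hx
      rw [← Real.exp_add, ← Real.exp_add, Real.exp_le_exp]
      have hR : R ^ 2 / (2 * c.re) = (x / t) ^ 2 / (2 * c.re) := by
        rw [div_pow, hx]; field_simp
      have key : 0 ≤ (x / t - c.re * t) ^ 2 / (2 * c.re) := by positivity
      have : (x / t - c.re * t) ^ 2 / (2 * c.re) =
          (x / t) ^ 2 / (2 * c.re) - x + c.re * t ^ 2 / 2 := by
        field_simp; ring
      rw [hR]
      linarith
    have h1 := hsq (R * t) rfl
    have h2 := hsq (-(R * t)) (by ring)
    have h3 : Real.exp (-c.re * t ^ 2) * Real.cosh (R * t) ≤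
        Real.exp (R ^ 2 / (2 * c.re)) * Real.exp (-(c.re / 2) * t ^ 2) := by
      rw [Real.cosh_eq]; linarith
    calc _ = t ^ (u.re - 1) * (Real.exp (-c.re * t ^ 2) * Real.cosh (R * t)) := by ring
      _ ≤ t ^ (u.re - 1) * (Real.exp (R ^ 2 / (2 * c.re)) * Real.exp (-(c.re / 2) * t ^ 2)) := by
        gcongr
      _ = _ := by ring
  · filter_upwards [ae_restrict_mem measurableSet_Ioi] with t ht
    exact (hh t ht).mul_left _

theorem one_div_cpow_add_natCast {c : ℂ} (hc : 0 < c.re) (w : ℂ) (k : ℕ) :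
    (1 / c) ^ (w + k) = (1 / c) ^ w * (1 / c) ^ k := by
  have hc0 : c ≠ 0 := by rintro rfl; simp at hc
  rw [Complex.cpow_add _ _ (one_div_ne_zero hc0), Complex.cpow_natCast]

theorem integral_gaussian_mul_cos_Ioi {s c : ℂ} (hs : 0 < s.re) (hc : 0 < c.re) (β : ℝ) :
    ∫ t : ℝ in Ioi 0, (t : ℂ) ^ (s - 1) * Complex.exp (-(c * (t : ℂ) ^ 2)) * Complex.cos (β * t)
      = 1 / 2 * (Complex.Gamma (s / 2) * (1 / c) ^ (s / 2) *
          oneFOne (s / 2) (1 / 2) (-(β : ℂ) ^ 2 / (4 * c))) := by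
  have h := hasSum_integral_gaussian_mul_even hs hc (B := 1) (R := |β|)
    (d := fun k => (-1) ^ k * (β : ℂ) ^ (2 * k) / ((2 * k).factorial : ℂ))
    (h := fun t => Complex.cos (β * t)) (fun k => ?_) (fun t _ => ?_)
  · refine h.unique ?_
    have hs2 : 0 < (s / 2).re := by simpa using hs
    have h2 := ((summable_oneFOne (z := -(β : ℂ) ^ 2 / (4 * c)) hs2
      (show 0 < (1 / 2 : ℂ).re by norm_num)).hasSum.mul_left
        (1 / 2 * (Complex.Gamma (s / 2) * (1 / c) ^ (s / 2))))
    rw [← mul_assoc]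
    convert! h2 using 2 with k
    rw [Gamma_add_natCast hs2, one_div_cpow_add_natCast hc, ← ascPochhammer_half_mul_factorial]
    have e2 := ascPochhammer_eval_ne_zero (show 0 < (1 / 2 : ℂ).re by norm_num) k
    have e5 : ((k.factorial : ℕ) : ℂ) ≠ 0 := by exact_mod_cast k.factorial_ne_zero
    have hc0 : c ≠ 0 := by rintro rfl; simp at hc
    have hz : (-(β : ℂ) ^ 2 / (4 * c)) ^ k = (-1) ^ k * (β : ℂ) ^ (2 * k) / 4 ^ k * (1 / c) ^ k := by
      rw [div_pow, mul_pow, neg_pow, ← pow_mul, div_pow, one_pow]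
      field_simp
    rw [hz]
    field_simp
  · simp
  · convert! Complex.hasSum_cos (β * t) using 2 with k
    rw [mul_pow]; ring

/-- `sin (βt) = t * (sin (βt) / t)` reduces to an even power series with `s` replaced by `s + 1`. -/
theorem integral_gaussian_mul_sin_Ioi {s c : ℂ} (hs : 0 < s.re) (hc : 0 < c.re) (β : ℝ) :
    ∫ t : ℝ in Ioi 0, (t : ℂ) ^ (s - 1) * Complex.exp (-(c * (t : ℂ) ^ 2)) * Complex.sin (β * t)
      = β / 2 * (Complex.Gamma ((s + 1) / 2) * (1 / c) ^ ((s + 1) / 2) *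
          oneFOne ((s + 1) / 2) (3 / 2) (-(β : ℂ) ^ 2 / (4 * c))) := by
  have hs1 : 0 < (s + 1).re := by simp; linarith
  have h := hasSum_integral_gaussian_mul_even hs1 hc (B := |β|) (R := |β|)
    (d := fun k => (-1) ^ k * (β : ℂ) ^ (2 * k + 1) / ((2 * k + 1).factorial : ℂ))
    (h := fun t => Complex.sin (β * t) / t) (fun k => ?_) (fun t ht => ?_)
  · have hI : ∫ t : ℝ in Ioi 0, (t : ℂ) ^ (s - 1) * Complex.exp (-(c * (t : ℂ) ^ 2)) *
        Complex.sin (β * t) = ∫ t : ℝ in Ioi 0, (t : ℂ) ^ (s + 1 - 1) *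
        Complex.exp (-(c * (t : ℂ) ^ 2)) * (Complex.sin (β * t) / t) := by
      refine setIntegral_congr_fun measurableSet_Ioi fun t ht => ?_
      have htc : (t : ℂ) ≠ 0 := by exact_mod_cast (ne_of_gt ht)
      have : (t : ℂ) ^ (s + 1 - 1) = (t : ℂ) ^ (s - 1) * t := by
        rw [show s + 1 - 1 = (s - 1) + 1 by ring, Complex.cpow_add _ _ htc, Complex.cpow_one]
      simp only [this]
      field_simp
    rw [hI]
    refine h.unique ?_
    have hs2 : 0 < ((s + 1) / 2).re := by simpa using hs1
    have h2 := ((summable_oneFOne (z := -(β : ℂ) ^ 2 / (4 * c)) hs2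
      (show 0 < (3 / 2 : ℂ).re by norm_num)).hasSum.mul_left
        (β / 2 * (Complex.Gamma ((s + 1) / 2) * (1 / c) ^ ((s + 1) / 2))))
    rw [← mul_assoc]
    convert! h2 using 2 with k
    rw [Gamma_add_natCast hs2, one_div_cpow_add_natCast hc,
      ← ascPochhammer_three_halves_mul_factorial]
    have e2 := ascPochhammer_eval_ne_zero (show 0 < (3 / 2 : ℂ).re by norm_num) k
    have e5 : ((k.factorial : ℕ) : ℂ) ≠ 0 := by exact_mod_cast k.factorial_ne_zero
    have hc0 : c ≠ 0 := by rintro rfl; simp at hc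
    have hz : (-(β : ℂ) ^ 2 / (4 * c)) ^ k = (-1) ^ k * (β : ℂ) ^ (2 * k) / 4 ^ k * (1 / c) ^ k := by
      rw [div_pow, mul_pow, neg_pow, ← pow_mul, div_pow, one_pow]
      field_simp
    rw [hz]
    field_simp
    ring
  · simp only [norm_div, norm_mul, norm_pow, norm_neg, norm_one, one_pow, one_mul,
      Complex.norm_real, Real.norm_eq_abs, Complex.norm_natCast]
    rw [pow_succ', mul_div_assoc]
    gcongr
    omega
  · have htc : (t : ℂ) ≠ 0 := by exact_mod_cast ht.ne'
    convert! (Complex.hasSum_sin (β * t)).div_const (t : ℂ) using 2 with k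
    rw [mul_pow]; field_simp; ring

/-! ### Test functions -/

theorem IsTestFunction.mul_contDiff {φ : ℝ → ℂ} (hφ : IsTestFunction φ) {g : ℝ → ℂ}
    (hg : ContDiff ℝ ∞ g) : IsTestFunction (fun x => g x * φ x) where
  smooth := hg.mul hφ.smooth
  compactSupport := hφ.compactSupport.mul_left
  zero_notMem := fun h => hφ.zero_notMem (tsupport_mul_subset_right h)

theorem IsTestFunction.deriv {φ : ℝ → ℂ} (hφ : IsTestFunction φ) : IsTestFunction (deriv φ) where
  smooth := hφ.smooth.deriv'
  compactSupport := hφ.compactSupport.deriv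
  zero_notMem := fun h => hφ.zero_notMem (tsupport_deriv_subset h)

theorem IsTestFunction.eventuallyEq_zero {φ : ℝ → ℂ} (hφ : IsTestFunction φ) : φ =ᶠ[𝓝 0] 0 :=
  notMem_tsupport_iff_eventuallyEq.1 hφ.zero_notMem

theorem IsTestFunction.integrable {φ : ℝ → ℂ} (hφ : IsTestFunction φ) : Integrable φ :=
  hφ.smooth.continuous.integrable_of_hasCompactSupport hφ.compactSupport

/-- Dividing by `|x|` turns the Haar measure of `ℝ^×` into Lebesgue measure, and keeps test
functions smooth because they vanish near `0`. -/
theorem IsTestFunction.div_abs {φ : ℝ → ℂ} (hφ : IsTestFunction φ) :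
    IsTestFunction (fun x => φ x / ((|x| : ℝ) : ℂ)) where
  smooth := by
    refine contDiff_iff_contDiffAt.2 fun x => ?_
    rcases eq_or_ne x 0 with rfl | hx
    · have : (fun x => φ x / ((|x| : ℝ) : ℂ)) =ᶠ[𝓝 0] fun _ => 0 := by
        filter_upwards [hφ.eventuallyEq_zero] with x hx
        simp [hx]
      exact contDiffAt_const.congr_of_eventuallyEq this
    · simp only [div_eq_mul_inv]
      refine hφ.smooth.contDiffAt.mul (ContDiffAt.inv ?_ ?_)
      · exact Complex.ofRealCLM.contDiff.contDiffAt.comp x (contDiffAt_abs hx)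
      · exact Complex.ofReal_ne_zero.2 (abs_ne_zero.2 hx)
  compactSupport := by
    simp only [div_eq_mul_inv]
    exact hφ.compactSupport.mul_right
  zero_notMem := by
    simp only [div_eq_mul_inv]
    exact fun h => hφ.zero_notMem (tsupport_mul_subset_left h)

/-! ### Gaussian characters and their convolutions -/

/-- The function `t ↦ e^{-c t² - iβt}`; the second degree character is the case `c = πai`,
`β = 2πb`, and `Re c > 0` makes the function rapidly decreasing. -/
noncomputable def gaussChar (c : ℂ) (β t : ℝ) : ℂ :=
  Complex.exp (-(c * (t : ℂ) ^ 2) - Complex.I * (β * t))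

theorem secondDegreeChar_eq_gaussChar (a b : ℝ) :
    secondDegreeChar a b = gaussChar (Real.pi * a * Complex.I) (2 * Real.pi * b) := by
  funext t
  simp only [secondDegreeChar, psi, gaussChar]
  congr 1
  push_cast
  ring

theorem norm_gaussChar (c : ℂ) (β t : ℝ) : ‖gaussChar c β t‖ = Real.exp (-c.re * t ^ 2) := by
  rw [gaussChar, Complex.norm_exp, Complex.sub_re, Complex.neg_re, ← Complex.ofReal_pow,
    Complex.re_mul_ofReal, ← Complex.ofReal_mul, Complex.re_mul_ofReal]
  simp

theorem norm_gaussChar_le_one {c : ℂ} (hc : 0 ≤ c.re) (β t : ℝ) : ‖gaussChar c β t‖ ≤ 1 := by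
  rw [norm_gaussChar, Real.exp_le_one_iff, neg_mul, neg_nonpos]
  positivity

@[fun_prop]
theorem measurable_gaussChar (c : ℂ) (β : ℝ) : Measurable (gaussChar c β) := by
  unfold gaussChar
  fun_prop

theorem integrable_mul_gaussChar {φ : ℝ → ℂ} (hφ : IsTestFunction φ) {c : ℂ} (hc : 0 ≤ c.re)
    (β y : ℝ) : Integrable (fun x => φ x * gaussChar c β (x⁻¹ * y)) := by
  refine hφ.integrable.norm.mono' ?_ (Eventually.of_forall fun x => ?_)
  · exact (hφ.smooth.continuous.measurable.mul
      ((measurable_gaussChar c β).comp (by fun_prop))).aestronglyMeasurable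
  · rw [norm_mul]
    exact mul_le_of_le_one_right (norm_nonneg _) (norm_gaussChar_le_one hc β _)

theorem mulConv_eq_integral (φ f : ℝ → ℂ) (y : ℝ) :
    mulConv φ f y = ∫ x : ℝ, φ x / ((|x| : ℝ) : ℂ) * f (x⁻¹ * y) := by
  simp only [mulConv, mulIntegral]
  congr 1
  funext x
  ring

theorem mulConvExists_gaussChar {φ : ℝ → ℂ} (hφ : IsTestFunction φ) {c : ℂ} (hc : 0 ≤ c.re)
    (β : ℝ) : MulConvExists φ (gaussChar c β) := by
  intro y _
  refine (integrable_mul_gaussChar hφ.div_abs hc β y).congr (Eventually.of_forall fun x => ?_)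
  ring

/-- One integration by parts: with `J(φ)(y) = ∫ φ(x) e^{-c(y/x)² - iβ(y/x)} dx`, differentiating
`x³ φ(x) e^{-c(y/x)² - iβ(y/x)}` gives `2cy² J(φ) = -J((x³φ)') - iβy J(xφ)`. -/
theorem integral_mul_gaussChar_by_parts {φ : ℝ → ℂ} (hφ : IsTestFunction φ) {c : ℂ}
    (hc : 0 ≤ c.re) (β y : ℝ) :
    (∫ x : ℝ, deriv (fun x : ℝ => (x : ℂ) ^ 3 * φ x) x * gaussChar c β (x⁻¹ * y)) +
      2 * c * y ^ 2 * (∫ x : ℝ, φ x * gaussChar c β (x⁻¹ * y)) +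
      Complex.I * β * y * (∫ x : ℝ, (x * φ x) * gaussChar c β (x⁻¹ * y)) = 0 := by
  have h3 : IsTestFunction (fun x : ℝ => (x : ℂ) ^ 3 * φ x) :=
    hφ.mul_contDiff (Complex.ofRealCLM.contDiff.pow 3)
  have h1 : IsTestFunction (fun x : ℝ => (x : ℂ) * φ x) :=
    hφ.mul_contDiff Complex.ofRealCLM.contDiff
  have i0 := integrable_mul_gaussChar h3.deriv hc β y
  have i1 := (integrable_mul_gaussChar hφ hc β y).const_mul (2 * c * y ^ 2)
  have i2 := (integrable_mul_gaussChar h1 hc β y).const_mul (Complex.I * β * y)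
  rw [← integral_const_mul, ← integral_const_mul, ← integral_add i0 i1]
  refine (integral_add (i0.add i1) i2).symm.trans ?_
  refine integral_eq_zero_of_hasDerivAt_of_integrable
    (f := fun x : ℝ => (x : ℂ) ^ 3 * φ x * gaussChar c β (x⁻¹ * y)) (fun x => ?_)
    ((i0.add i1).add i2) (integrable_mul_gaussChar h3 hc β y)
  rcases eq_or_ne x 0 with rfl | hx
  · -- `x ↦ e^{-c(y/x)² - iβ(y/x)}` is singular at `0`, but `φ` vanishes near `0`.
    have hz : (fun x : ℝ => (x : ℂ) ^ 3 * φ x * gaussChar c β (x⁻¹ * y)) =ᶠ[𝓝 0] fun _ => 0 := by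
      filter_upwards [hφ.eventuallyEq_zero] with x hx
      simp [hx]
    have hφ0 : φ 0 = 0 := hφ.eventuallyEq_zero.eq_of_nhds
    have hd0 : deriv (fun x : ℝ => (x : ℂ) ^ 3 * φ x) 0 = 0 := h3.deriv.eventuallyEq_zero.eq_of_nhds
    convert! (hasDerivAt_const (0 : ℝ) (0 : ℂ)).congr_of_eventuallyEq hz using 1
    simp [hφ0, hd0]
  · have hxc : (x : ℂ) ≠ 0 := by exact_mod_cast hx
    have hA : HasDerivAt (fun x : ℝ => (x : ℂ) ^ 3 * φ x)
        (deriv (fun x : ℝ => (x : ℂ) ^ 3 * φ x) x) x :=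
      (h3.smooth.differentiable (by simp) x).hasDerivAt
    have hinv : HasDerivAt (fun x : ℝ => ((x⁻¹ * y : ℝ) : ℂ)) ((-(x ^ 2)⁻¹ * y : ℝ) : ℂ) x :=
      ((hasDerivAt_inv hx).mul_const y).ofReal_comp
    have hE : HasDerivAt (fun x : ℝ => gaussChar c β (x⁻¹ * y)) (gaussChar c β (x⁻¹ * y) *
        (2 * c * y ^ 2 / x ^ 3 + Complex.I * β * y / x ^ 2)) x := by
      have h := (((hinv.pow 2).const_mul c).neg.sub
        ((hinv.const_mul (β : ℂ)).const_mul Complex.I)).cexp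
      refine h.congr_deriv ?_
      change gaussChar c β (x⁻¹ * y) * _ = _
      congr 1
      push_cast
      field_simp
      ring
    refine (hA.mul hE).congr_deriv ?_
    simp only [Pi.add_apply]
    field_simp
    ring

/-- The convolution integrals of Gaussian characters decay faster than any power, uniformly in the
closed right half plane away from `c = 0`. -/
theorem exists_norm_integral_mul_gaussChar_le {φ : ℝ → ℂ} (hφ : IsTestFunction φ) {δ : ℝ}
    (hδ : 0 < δ) (β : ℝ) (n : ℕ) :
    ∃ C : ℝ, ∀ c : ℂ, 0 ≤ c.re → δ ≤ ‖c‖ → ∀ y : ℝ,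
      (1 + |y|) ^ n * ‖∫ x : ℝ, φ x * gaussChar c β (x⁻¹ * y)‖ ≤ C := by
  have hbase : ∀ {ψ : ℝ → ℂ}, IsTestFunction ψ → ∀ c : ℂ, 0 ≤ c.re → ∀ y : ℝ,
      ‖∫ x : ℝ, ψ x * gaussChar c β (x⁻¹ * y)‖ ≤ ∫ x : ℝ, ‖ψ x‖ := by
    intro ψ hψ c hc y
    refine norm_integral_le_of_norm_le hψ.integrable.norm (Eventually.of_forall fun x => ?_)
    rw [norm_mul]
    exact mul_le_of_le_one_right (norm_nonneg _) (norm_gaussChar_le_one hc β _)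
  induction n generalizing φ with
  | zero => exact ⟨∫ x : ℝ, ‖φ x‖, fun c hc _ y => by simpa using hbase hφ c hc y⟩
  | succ n ih =>
    have h3 : IsTestFunction (fun x : ℝ => (x : ℂ) ^ 3 * φ x) :=
      hφ.mul_contDiff (Complex.ofRealCLM.contDiff.pow 3)
    have h1 : IsTestFunction (fun x : ℝ => (x : ℂ) * φ x) :=
      hφ.mul_contDiff Complex.ofRealCLM.contDiff
    obtain ⟨C₁, hC₁⟩ := ih h3.deriv
    obtain ⟨C₂, hC₂⟩ := ih h1
    refine ⟨max (2 ^ (n + 1) * ∫ x : ℝ, ‖φ x‖) ((C₁ + |β| * C₂) / δ), fun c hc hcδ y => ?_⟩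
    -- For `|y| ≤ 1` the trivial bound suffices; for `|y| ≥ 1` one integration by parts gains a
    -- factor `1 / |y|`.
    rcases le_total |y| 1 with hy | hy
    · refine le_trans ?_ (le_max_left _ _)
      gcongr
      · linarith
      · exact hbase hφ c hc y
    · refine le_trans ?_ (le_max_right _ _)
      have hparts := integral_mul_gaussChar_by_parts hφ hc β y
      have hb₁ := hC₁ c hc hcδ y
      have hb₂ := hC₂ c hc hcδ y
      set J := ∫ x : ℝ, φ x * gaussChar c β (x⁻¹ * y)
      set J₁ := ∫ x : ℝ, deriv (fun x : ℝ => (x : ℂ) ^ 3 * φ x) x * gaussChar c β (x⁻¹ * y)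
      set J₂ := ∫ x : ℝ, (x * φ x) * gaussChar c β (x⁻¹ * y)
      have hJ : 2 * c * y ^ 2 * J = -J₁ - Complex.I * β * y * J₂ := by
        linear_combination hparts
      have hJn : 2 * ‖c‖ * |y| ^ 2 * ‖J‖ ≤ ‖J₁‖ + |β| * |y| * ‖J₂‖ := by
        have := congrArg norm hJ
        have h2 := norm_sub_le (-J₁) (Complex.I * β * y * J₂)
        rw [← this] at h2
        simpa using h2
      have hJn' : 2 * δ * |y| * ‖J‖ ≤ ‖J₁‖ + |β| * ‖J₂‖ := by
        have hy0 : 0 < |y| := by linarith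
        refine le_of_mul_le_mul_right ?_ hy0
        calc 2 * δ * |y| * ‖J‖ * |y| = 2 * δ * |y| ^ 2 * ‖J‖ := by ring
          _ ≤ 2 * ‖c‖ * |y| ^ 2 * ‖J‖ := by gcongr
          _ ≤ ‖J₁‖ + |β| * |y| * ‖J₂‖ := hJn
          _ ≤ ‖J₁‖ * |y| + |β| * |y| * ‖J₂‖ := by
            gcongr
            exact le_mul_of_one_le_right (norm_nonneg _) hy
          _ = _ := by ring
      rw [le_div_iff₀ hδ]
      have hp : 0 ≤ (1 + |y|) ^ n := by positivity
      calc (1 + |y|) ^ (n + 1) * ‖J‖ * δ = (1 + |y|) ^ n * (δ * (1 + |y|) * ‖J‖) := by ring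
        _ ≤ (1 + |y|) ^ n * (2 * δ * |y| * ‖J‖) := by
          refine mul_le_mul_of_nonneg_left ?_ hp
          have : 0 ≤ δ * (|y| - 1) * ‖J‖ :=
            mul_nonneg (mul_nonneg hδ.le (by linarith)) (norm_nonneg _)
          linarith
        _ ≤ (1 + |y|) ^ n * (‖J₁‖ + |β| * ‖J₂‖) := mul_le_mul_of_nonneg_left hJn' hp
        _ = (1 + |y|) ^ n * ‖J₁‖ + |β| * ((1 + |y|) ^ n * ‖J₂‖) := by ring
        _ ≤ C₁ + |β| * C₂ := by gcongr

/-! ### Integrable majorants -/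

theorem integrable_comp_abs {f : ℝ → ℝ} (hf : IntegrableOn f (Ioi 0)) :
    Integrable (fun x : ℝ => f |x|) := by
  have h1 : IntegrableOn (fun x : ℝ => f |x|) (Ioi 0) :=
    hf.congr_fun (fun x hx => by simp only [abs_of_pos (show (0 : ℝ) < x from hx)]) measurableSet_Ioi
  have h2 : IntegrableOn (fun x : ℝ => f |x|) (Iic 0) := by
    rw [← Measure.map_neg_eq_self (volume : Measure ℝ)]
    let m : MeasurableEmbedding fun x : ℝ => -x := (Homeomorph.neg ℝ).measurableEmbedding
    rw [m.integrableOn_map_iff]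
    simp_rw [Function.comp_def, abs_neg, neg_preimage, neg_Iic, neg_zero]
    exact Iff.mpr integrableOn_Ici_iff_integrableOn_Ioi h1
  rw [← integrableOn_univ, ← Iic_union_Ioi (a := (0 : ℝ))]
  exact h2.union h1

theorem integrable_abs_rpow_mul_exp_neg_mul_sq {κ σ : ℝ} (hκ : 0 < κ) (hσ : 0 < σ) :
    Integrable (fun x : ℝ => |x| ^ (σ - 1) * Real.exp (-κ * x ^ 2)) := by
  have := integrable_comp_abs
    (integrableOn_rpow_mul_exp_neg_mul_sq hκ (show -1 < σ - 1 by linarith))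
  simpa only [sq_abs] using this

theorem integrable_abs_rpow_mul_one_add_abs_pow_inv {σ : ℝ} (hσ : 0 < σ) {n : ℕ} (hn : σ < n) :
    Integrable (fun x : ℝ => |x| ^ (σ - 1) * ((1 + |x|) ^ n)⁻¹) := by
  refine integrable_comp_abs (f := fun x : ℝ => x ^ (σ - 1) * ((1 + x) ^ n)⁻¹) ?_
  rw [← Ioc_union_Ioi_eq_Ioi (zero_le_one (α := ℝ))]
  refine IntegrableOn.union ?_ ?_
  · have h := (intervalIntegral.intervalIntegrable_rpow' (a := 0) (b := 1)
      (show -1 < σ - 1 by linarith)).1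
    refine h.mono' (Measurable.aestronglyMeasurable (by fun_prop)) ?_
    filter_upwards [ae_restrict_mem measurableSet_Ioc] with x hx
    have hx0 : 0 < x := hx.1
    rw [Real.norm_of_nonneg (by positivity)]
    exact mul_le_of_le_one_right (by positivity)
      (inv_le_one_of_one_le₀ (one_le_pow₀ (by linarith)))
  · have h := integrableOn_Ioi_rpow_of_lt (show σ - 1 - n < -1 by linarith) zero_lt_one
    refine h.mono' (Measurable.aestronglyMeasurable (by fun_prop)) ?_
    filter_upwards [ae_restrict_mem measurableSet_Ioi] with x hx
    have hx0 : 0 < x := zero_lt_one.trans hx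
    rw [Real.norm_of_nonneg (by positivity), Real.rpow_sub hx0 (σ - 1), Real.rpow_natCast,
      div_eq_mul_inv]
    gcongr
    linarith

/-- At `y = 0` the left side is `0`, by the convention for division by `0`. -/
theorem norm_cpow_div_abs_le (s : ℂ) (y : ℝ) :
    ‖((|y| : ℝ) : ℂ) ^ s / ((|y| : ℝ) : ℂ)‖ ≤ |y| ^ (s.re - 1) := by
  rcases eq_or_ne y 0 with rfl | hy
  · simp only [abs_zero, Complex.ofReal_zero, div_zero, norm_zero]
    positivity
  · have h0 : 0 < |y| := abs_pos.2 hy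
    rw [norm_div, Complex.norm_cpow_eq_rpow_re_of_pos h0, Complex.norm_real,
      Real.norm_of_nonneg h0.le, Real.rpow_sub_one h0.ne']

/-! ### Multiplicativity of the Mellin transform -/

theorem norm_mul_cpow_mul_div_abs_le (s : ℂ) {χ : ℝ → ℂ} (hχn : ∀ x, ‖χ x‖ ≤ 1) (z : ℂ) (y : ℝ) :
    ‖z * ((|y| : ℝ) : ℂ) ^ s * χ y / ((|y| : ℝ) : ℂ)‖ ≤ ‖z‖ * |y| ^ (s.re - 1) := by
  have : z * ((|y| : ℝ) : ℂ) ^ s * χ y / ((|y| : ℝ) : ℂ) =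
      z * (((|y| : ℝ) : ℂ) ^ s / ((|y| : ℝ) : ℂ)) * χ y := by ring
  rw [this, norm_mul, norm_mul]
  refine (mul_le_of_le_one_right (by positivity) (hχn y)).trans ?_
  gcongr
  exact norm_cpow_div_abs_le s y

theorem mellinExists_gaussChar {s c : ℂ} (hs : 0 < s.re) (hc : 0 < c.re) (β : ℝ) {χ : ℝ → ℂ}
    (hχm : Measurable χ) (hχn : ∀ x, ‖χ x‖ ≤ 1) : MellinExists (gaussChar c β) s χ := by
  refine (integrable_abs_rpow_mul_exp_neg_mul_sq hc hs).mono' ?_ (Eventually.of_forall fun y => ?_)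
  · exact Measurable.aestronglyMeasurable (by fun_prop)
  · refine (norm_mul_cpow_mul_div_abs_le s hχn _ y).trans_eq ?_
    rw [norm_gaussChar, mul_comm]

/-- The change of variables `y = x t` in the Mellin integral of a dilated function. -/
theorem integral_inv_mul_mellin (f : ℝ → ℂ) (s : ℂ) {χ : ℝ → ℂ}
    (hχ : ∀ x y, χ (x * y) = χ x * χ y) {x : ℝ} (hx : x ≠ 0) :
    ∫ y : ℝ, f (x⁻¹ * y) * ((|y| : ℝ) : ℂ) ^ s * χ y / ((|y| : ℝ) : ℂ) =
      ((|x| : ℝ) : ℂ) ^ s * χ x * mellinReal f s χ := by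
  have h := Measure.integral_comp_div
    (fun t : ℝ => f t * ((|x * t| : ℝ) : ℂ) ^ s * χ (x * t) / ((|x * t| : ℝ) : ℂ)) x
  have h1 : ∀ y : ℝ, x * (y / x) = y := fun y => by field_simp
  have h2 : ∀ y : ℝ, y / x = x⁻¹ * y := fun y => by field_simp
  simp only [h1] at h
  simp only [h2] at h
  rw [h, mellinReal, mulIntegral, ← integral_const_mul, ← integral_smul]
  congr 1
  funext t
  have hxc : ((|x| : ℝ) : ℂ) ≠ 0 := Complex.ofReal_ne_zero.2 (abs_ne_zero.2 hx)
  rw [abs_mul, Complex.ofReal_mul, Complex.mul_cpow_ofReal_nonneg (abs_nonneg _) (abs_nonneg _), hχ,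
    Complex.real_smul]
  field_simp

/-- For `Re c > 0` the Mellin integral converges absolutely, so Fubini and the substitution `y = xt`
give the product formula. -/
theorem mellinReal_mulConv_gaussChar {φ : ℝ → ℂ} (hφ : IsTestFunction φ) {s c : ℂ}
    (hs : 0 < s.re) (hc : 0 < c.re) (β : ℝ) {χ : ℝ → ℂ} (hχm : Measurable χ)
    (hχn : ∀ x, ‖χ x‖ ≤ 1) (hχ : ∀ x y, χ (x * y) = χ x * χ y) :
    mellinReal (mulConv φ (gaussChar c β)) s χ =
      mellinReal (gaussChar c β) s χ * mellinReal φ s χ := by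
  set g : ℝ → ℂ := fun x => φ x / ((|x| : ℝ) : ℂ) with hg
  have hgt : IsTestFunction g := hφ.div_abs
  obtain ⟨R, hR0, hR⟩ : ∃ R : ℝ, 0 < R ∧ ∀ x, g x ≠ 0 → |x| ≤ R := by
    obtain ⟨R, hR0, hR⟩ := hgt.compactSupport.isCompact.isBounded.exists_pos_norm_le
    exact ⟨R, hR0, fun x hx => hR x (subset_tsupport g hx)⟩
  have hg0 : g 0 = 0 := by simp [hg]
  have hint : Integrable (Function.uncurry fun y x : ℝ =>
      g x * (gaussChar c β (x⁻¹ * y) * ((|y| : ℝ) : ℂ) ^ s * χ y / ((|y| : ℝ) : ℂ)))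
      (volume.prod volume) := by
    -- Where `φ x ≠ 0` one has `|x| ≤ R`, hence `|e^{-c(y/x)²}| ≤ e^{-(Re c / R²) y²}`.
    have hmaj := (integrable_abs_rpow_mul_exp_neg_mul_sq (κ := c.re / R ^ 2) (by positivity)
      hs).mul_prod hgt.integrable.norm
    refine hmaj.mono' ?_ (Eventually.of_forall fun p => ?_)
    · have hgm : Measurable g := hgt.smooth.continuous.measurable
      exact Measurable.aestronglyMeasurable (by unfold Function.uncurry; fun_prop)
    · obtain ⟨y, x⟩ := p
      simp only [Function.uncurry]
      rcases eq_or_ne (g x) 0 with h0 | h0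
      · simp [h0]
      have hx0 : x ≠ 0 := by rintro rfl; exact h0 hg0
      have hxR : x ^ 2 ≤ R ^ 2 := by
        rw [← sq_abs x]
        exact pow_le_pow_left₀ (abs_nonneg _) (hR x h0) 2
      have hx2 : 0 < x ^ 2 := by positivity
      rw [norm_mul, mul_comm]
      refine mul_le_mul_of_nonneg_right ?_ (norm_nonneg _)
      refine (norm_mul_cpow_mul_div_abs_le s hχn _ y).trans ?_
      rw [norm_gaussChar, mul_comm]
      refine mul_le_mul_of_nonneg_left (Real.exp_le_exp.2 ?_) (by positivity)
      have : c.re / R ^ 2 * y ^ 2 ≤ c.re / x ^ 2 * y ^ 2 := by gcongr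
      have h2 : c.re * (x⁻¹ * y) ^ 2 = c.re / x ^ 2 * y ^ 2 := by field_simp
      linarith
  calc mellinReal (mulConv φ (gaussChar c β)) s χ
      = ∫ y : ℝ, ∫ x : ℝ,
          g x * (gaussChar c β (x⁻¹ * y) * ((|y| : ℝ) : ℂ) ^ s * χ y / ((|y| : ℝ) : ℂ)) := by
        rw [mellinReal, mulIntegral]
        congr 1
        funext y
        rw [mulConv_eq_integral, mul_assoc, mul_div_assoc, ← integral_mul_const]
        congr 1
        funext x
        simp only [hg]
        ring
    _ = ∫ x : ℝ, ∫ y : ℝ,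
          g x * (gaussChar c β (x⁻¹ * y) * ((|y| : ℝ) : ℂ) ^ s * χ y / ((|y| : ℝ) : ℂ)) :=
        integral_integral_swap hint
    _ = ∫ x : ℝ, mellinReal (gaussChar c β) s χ *
          (φ x * ((|x| : ℝ) : ℂ) ^ s * χ x / ((|x| : ℝ) : ℂ)) := by
        congr 1
        funext x
        rcases eq_or_ne x 0 with rfl | hx
        · simp [hg0]
        rw [integral_const_mul, integral_inv_mul_mellin _ s hχ hx]
        simp only [hg]
        ring
    _ = _ := by rw [integral_const_mul]; rfl

/-! ### Removing the Gaussian regularisation -/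

/-- A majorant of the Mellin integrand of `φ ⋆ f`, uniform in the regularisation; it is integrable
once `n > Re s`. -/
theorem exists_norm_mellin_mulConv_gaussChar_le {φ : ℝ → ℂ} (hφ : IsTestFunction φ) {s : ℂ}
    {δ : ℝ} (hδ : 0 < δ) (β : ℝ) {χ : ℝ → ℂ} (hχn : ∀ x, ‖χ x‖ ≤ 1) (n : ℕ) :
    ∃ C : ℝ, ∀ c : ℂ, 0 ≤ c.re → δ ≤ ‖c‖ → ∀ y : ℝ,
      ‖mulConv φ (gaussChar c β) y * ((|y| : ℝ) : ℂ) ^ s * χ y / ((|y| : ℝ) : ℂ)‖ ≤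
        C * (|y| ^ (s.re - 1) * ((1 + |y|) ^ n)⁻¹) := by
  obtain ⟨C, hC⟩ := exists_norm_integral_mul_gaussChar_le hφ.div_abs hδ β n
  refine ⟨C, fun c hc hcδ y => (norm_mul_cpow_mul_div_abs_le s hχn _ y).trans ?_⟩
  have h := hC c hc hcδ y
  rw [← mulConv_eq_integral] at h
  have hp : 0 < (1 + |y|) ^ n := by positivity
  have h2 : ‖mulConv φ (gaussChar c β) y‖ ≤ C * ((1 + |y|) ^ n)⁻¹ := by
    rw [← div_eq_mul_inv, le_div_iff₀ hp, mul_comm]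
    exact h
  calc _ ≤ C * ((1 + |y|) ^ n)⁻¹ * |y| ^ (s.re - 1) := by gcongr
    _ = _ := by ring

theorem measurable_mulConv_gaussChar {φ : ℝ → ℂ} (hφ : IsTestFunction φ) (c : ℂ) (β : ℝ) :
    Measurable (mulConv φ (gaussChar c β)) := by
  have hφm : Measurable φ := hφ.smooth.continuous.measurable
  have h : StronglyMeasurable (Function.uncurry fun y x : ℝ =>
      φ x / ((|x| : ℝ) : ℂ) * gaussChar c β (x⁻¹ * y)) :=
    Measurable.stronglyMeasurable (by unfold Function.uncurry; fun_prop)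
  have heq : mulConv φ (gaussChar c β) =
      fun y => ∫ x : ℝ, φ x / ((|x| : ℝ) : ℂ) * gaussChar c β (x⁻¹ * y) :=
    funext (mulConv_eq_integral φ _)
  rw [heq]
  exact (h.integral_prod_right (ν := volume)).measurable

/-- Let `c₀ ≠ 0` be purely imaginary. If the Mellin transforms of `e^{-(c₀ + ε)t² - iβt}` converge
as `ε → 0⁺`, the limit is a weak Mellin transform of the unregularised character. -/
theorem isWeakMellin_gaussChar_of_tendsto {c₀ : ℂ} (hre : c₀.re = 0) (hc₀ : c₀ ≠ 0) {s : ℂ}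
    (hs : 0 < s.re) (β : ℝ) {χ : ℝ → ℂ} (hχm : Measurable χ) (hχn : ∀ x, ‖χ x‖ ≤ 1)
    (hχ : ∀ x y, χ (x * y) = χ x * χ y) {M : ℂ}
    (hM : Tendsto (fun ε : ℝ => mellinReal (gaussChar (c₀ + ε) β) s χ) (𝓝[>] 0) (𝓝 M)) :
    IsWeakMellin (gaussChar c₀ β) s χ M := by
  intro φ hφ
  obtain ⟨n, hn⟩ := exists_nat_gt s.re
  have hδ : 0 < ‖c₀‖ := norm_pos_iff.2 hc₀
  obtain ⟨C, hC⟩ := exists_norm_mellin_mulConv_gaussChar_le hφ (s := s) hδ β hχn n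
  have hbound := (integrable_abs_rpow_mul_one_add_abs_pow_inv hs hn).const_mul C
  have hmeas : ∀ c : ℂ, AEStronglyMeasurable (fun y : ℝ =>
      mulConv φ (gaussChar c β) y * ((|y| : ℝ) : ℂ) ^ s * χ y / ((|y| : ℝ) : ℂ)) := by
    intro c
    have := measurable_mulConv_gaussChar hφ c β
    exact Measurable.aestronglyMeasurable (by fun_prop)
  have hreε : ∀ ε : ℝ, (c₀ + ε).re = ε := fun ε => by simp [hre]
  have hnormε : ∀ ε : ℝ, ‖c₀‖ ≤ ‖c₀ + ε‖ := by
    intro ε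
    have h1 : ‖c₀‖ = |c₀.im| := by
      rw [← Complex.re_add_im c₀, hre]; simp
    have h2 := Complex.abs_im_le_norm (c₀ + ε)
    rw [h1]
    simpa using h2
  have hpos : ∀ᶠ ε : ℝ in 𝓝[>] 0, 0 < ε := eventually_mem_nhdsWithin
  refine ⟨mulConvExists_gaussChar hφ hre.ge β, ?_, ?_⟩
  · exact hbound.mono' (hmeas c₀) (Eventually.of_forall (hC c₀ hre.ge le_rfl))
  · have hconv : ∀ y : ℝ, Tendsto (fun ε : ℝ => mulConv φ (gaussChar (c₀ + ε) β) y) (𝓝[>] 0)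
        (𝓝 (mulConv φ (gaussChar c₀ β) y)) := by
      intro y
      simp only [mulConv_eq_integral]
      refine tendsto_integral_filter_of_dominated_convergence
        (fun x => ‖φ x / ((|x| : ℝ) : ℂ)‖) ?_ ?_ hφ.div_abs.integrable.norm ?_
      · filter_upwards [hpos] with ε hε
        exact (integrable_mul_gaussChar hφ.div_abs
          (by rw [hreε]; exact hε.le) β y).aestronglyMeasurable
      · filter_upwards [hpos] with ε hε
        refine Eventually.of_forall fun x => ?_
        rw [norm_mul]
        exact mul_le_of_le_one_right (norm_nonneg _)
          (norm_gaussChar_le_one (by rw [hreε]; exact hε.le) β _)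
      · refine Eventually.of_forall fun x => ?_
        have hcont : Continuous fun ε : ℝ => φ x / ((|x| : ℝ) : ℂ) *
            gaussChar (c₀ + ε) β (x⁻¹ * y) := by
          unfold gaussChar
          fun_prop
        have := hcont.tendsto 0
        simp only [Complex.ofReal_zero, add_zero] at this
        exact this.mono_left nhdsWithin_le_nhds
    have hlim : Tendsto (fun ε : ℝ => mellinReal (mulConv φ (gaussChar (c₀ + ε) β)) s χ) (𝓝[>] 0)
        (𝓝 (mellinReal (mulConv φ (gaussChar c₀ β)) s χ)) := by
      refine tendsto_integral_filter_of_dominated_convergence _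
        (Eventually.of_forall fun ε => hmeas _) ?_ hbound ?_
      · filter_upwards [hpos] with ε hε
        exact Eventually.of_forall (hC _ (by rw [hreε]; exact hε.le) (hnormε ε))
      · exact Eventually.of_forall fun y => (((hconv y).mul_const _).mul_const _).div_const _
    refine tendsto_nhds_unique hlim ((hM.mul_const (mellinReal φ s χ)).congr' ?_)
    filter_upwards [hpos] with ε hε
    exact (mellinReal_mulConv_gaussChar hφ hs (by rw [hreε]; exact hε) β hχm hχn hχ).symm

/-! ### Uniqueness of weak Mellin transforms -/

/-- A weak Mellin transform is determined by any test function supported in `(0, ∞)` whose own Mellin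
transform does not vanish. -/
theorem exists_isTestFunction_mellinReal_ne_zero (s : ℂ) {χ : ℝ → ℂ}
    (hχ : ∀ x : ℝ, 0 < x → χ x = 1) : ∃ φ, IsTestFunction φ ∧ mellinReal φ s χ ≠ 0 := by
  let b : ContDiffBump (1 : ℝ) := ⟨1 / 4, 1 / 2, by norm_num, by norm_num⟩
  have hb : ∀ x ∈ tsupport b, 0 < x := by
    intro x hx
    rw [b.tsupport_eq, Metric.mem_closedBall, Real.dist_eq] at hx
    have h1 : b.rOut = 1 / 2 := rfl
    rw [h1] at hx
    have := (abs_le.1 hx).1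
    linarith
  have hb' : ∀ x : ℝ, b x ≠ 0 → 0 < x := fun x hx => hb x (subset_tsupport _ hx)
  -- The weight `e^{(1-s) log x}` cancels the factor `|x|^s / |x|` of the Mellin integrand.
  let φ : ℝ → ℂ := fun x => (b x : ℂ) * Complex.exp ((1 - s) * Real.log x)
  have hsub : tsupport φ ⊆ tsupport b := by
    refine closure_mono fun x hx => ?_
    simp only [Function.mem_support, φ] at hx ⊢
    intro h
    simp [h] at hx
  refine ⟨φ, ⟨?_, ?_, fun h => (hb 0 (hsub h)).false⟩, ?_⟩
  · refine contDiff_iff_contDiffAt.2 fun x => ?_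
    rcases le_or_gt x 0 with hx | hx
    · have : x ∉ tsupport φ := fun h => absurd (hb x (hsub h)) hx.not_gt
      exact contDiffAt_const.congr_of_eventuallyEq (notMem_tsupport_iff_eventuallyEq.1 this)
    · refine (Complex.ofRealCLM.contDiff.contDiffAt.comp x b.contDiffAt).mul ?_
      exact (contDiffAt_const.mul (Complex.ofRealCLM.contDiff.contDiffAt.comp x
        (Real.contDiffAt_log.2 hx.ne'))).cexp
  · exact b.hasCompactSupport.of_isClosed_subset (isClosed_tsupport _) hsub
  · have : mellinReal φ s χ = ((∫ x : ℝ, b x : ℝ) : ℂ) := by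
      rw [mellinReal, mulIntegral, ← integral_complex_ofReal]
      congr 1
      funext x
      by_cases h0 : b x = 0
      · simp [φ, h0]
      have hx := hb' x h0
      have hxc : (x : ℂ) ≠ 0 := by exact_mod_cast hx.ne'
      simp only [φ, hχ x hx, abs_of_pos hx]
      rw [Complex.ofReal_log hx.le, mul_comm (1 - s), ← Complex.cpow_def_of_ne_zero hxc,
        mul_one, mul_assoc, ← Complex.cpow_add _ _ hxc, sub_add_cancel, Complex.cpow_one,
        mul_div_cancel_right₀ _ hxc]
    rw [this]
    exact Complex.ofReal_ne_zero.2 b.integral_pos.ne'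

theorem IsWeakMellin.unique {f : ℝ → ℂ} {s : ℂ} {χ : ℝ → ℂ} (hχ : ∀ x : ℝ, 0 < x → χ x = 1)
    {M N : ℂ} (hM : IsWeakMellin f s χ M) (hN : IsWeakMellin f s χ N) : M = N := by
  obtain ⟨φ, hφ, h0⟩ := exists_isTestFunction_mellinReal_ne_zero s hχ
  exact mul_right_cancel₀ h0 ((hM φ hφ).2.2.symm.trans (hN φ hφ).2.2)

/-! ### The weak Mellin transforms of second degree characters -/

/-- Folding the negative half line onto the positive one. -/
theorem mellinReal_gaussChar_eq_integral_Ioi {s c : ℂ} (hs : 0 < s.re) (hc : 0 < c.re) (β : ℝ)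
    {χ : ℝ → ℂ} (hχm : Measurable χ) (hχn : ∀ x, ‖χ x‖ ≤ 1) :
    mellinReal (gaussChar c β) s χ =
      ∫ t : ℝ in Ioi 0, (t : ℂ) ^ (s - 1) * Complex.exp (-(c * (t : ℂ) ^ 2)) *
        (χ t * Complex.exp (-(β * t) * Complex.I) + χ (-t) * Complex.exp ((β * t) * Complex.I)) := by
  have hI : Integrable (fun x : ℝ =>
    gaussChar c β x * ((|x| : ℝ) : ℂ) ^ s * χ x / ((|x| : ℝ) : ℂ)) :=
    mellinExists_gaussChar hs hc β hχm hχn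
  rw [mellinReal, mulIntegral, ← integral_add_compl (measurableSet_Ioi (a := (0 : ℝ))) hI,
    compl_Ioi]
  have hneg := integral_comp_neg_Ioi (0 : ℝ)
    (fun x : ℝ => gaussChar c β x * ((|x| : ℝ) : ℂ) ^ s * χ x / ((|x| : ℝ) : ℂ))
  rw [neg_zero] at hneg
  rw [← hneg, ← integral_add hI.integrableOn hI.comp_neg.integrableOn]
  refine setIntegral_congr_fun measurableSet_Ioi fun t ht => ?_
  have ht0 : 0 < t := ht
  have htc : (t : ℂ) ≠ 0 := by exact_mod_cast ht0.ne'
  simp only [abs_neg, abs_of_pos ht0, gaussChar]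
  rw [Complex.cpow_sub _ _ htc, Complex.cpow_one,
    show -(c * (t : ℂ) ^ 2) - Complex.I * (β * t) =
      -(c * (t : ℂ) ^ 2) + -(β * t) * Complex.I by ring,
    show -(c * ((-t : ℝ) : ℂ) ^ 2) - Complex.I * (β * ((-t : ℝ) : ℂ)) =
      -(c * (t : ℂ) ^ 2) + (β * t) * Complex.I by push_cast; ring, Complex.exp_add, Complex.exp_add]
  ring

theorem measurable_trivialChar : Measurable trivialChar := measurable_const

theorem norm_trivialChar_le_one (x : ℝ) : ‖trivialChar x‖ ≤ 1 := by simp [trivialChar]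

theorem signChar_of_pos {x : ℝ} (hx : 0 < x) : signChar x = 1 := by
  simp [signChar, Real.sign_of_pos hx]

theorem signChar_of_neg {x : ℝ} (hx : x < 0) : signChar x = -1 := by
  simp [signChar, Real.sign_of_neg hx]

theorem signChar_zero : signChar 0 = 0 := by simp [signChar]

theorem measurable_signChar : Measurable signChar := by
  refine Complex.measurable_ofReal.comp ?_
  unfold Real.sign
  exact Measurable.ite measurableSet_Iio measurable_const
    (Measurable.ite measurableSet_Ioi measurable_const measurable_const)

theorem norm_signChar_le_one (x : ℝ) : ‖signChar x‖ ≤ 1 := by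
  rcases lt_trichotomy x 0 with h | rfl | h
  · simp [signChar_of_neg h]
  · simp [signChar_zero]
  · simp [signChar_of_pos h]

theorem signChar_mul (x y : ℝ) : signChar (x * y) = signChar x * signChar y := by
  rcases lt_trichotomy x 0 with hx | rfl | hx <;> rcases lt_trichotomy y 0 with hy | rfl | hy <;>
    simp [signChar_zero, signChar_of_neg, signChar_of_pos, mul_pos_of_neg_of_neg,
      mul_neg_of_neg_of_pos, mul_neg_of_pos_of_neg, *]

theorem mellinReal_gaussChar_trivialChar {s c : ℂ} (hs : 0 < s.re) (hc : 0 < c.re) (β : ℝ) :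
    mellinReal (gaussChar c β) s trivialChar =
      Complex.Gamma (s / 2) * (1 / c) ^ (s / 2) *
        oneFOne (s / 2) (1 / 2) (-(β : ℂ) ^ 2 / (4 * c)) := by
  rw [mellinReal_gaussChar_eq_integral_Ioi hs hc β measurable_trivialChar norm_trivialChar_le_one]
  have h := integral_gaussian_mul_cos_Ioi hs hc β
  have h2 := congrArg (fun z => 2 * z) h
  simp only [← integral_const_mul] at h2
  refine Eq.trans ?_ (h2.trans (by ring))
  congr 1
  funext t
  rw [Complex.cos]
  simp only [trivialChar]
  ring

theorem mellinReal_gaussChar_signChar {s c : ℂ} (hs : 0 < s.re) (hc : 0 < c.re) (β : ℝ) :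
    mellinReal (gaussChar c β) s signChar =
      -Complex.I * β * (Complex.Gamma ((s + 1) / 2) * (1 / c) ^ ((s + 1) / 2) *
        oneFOne ((s + 1) / 2) (3 / 2) (-(β : ℂ) ^ 2 / (4 * c))) := by
  rw [mellinReal_gaussChar_eq_integral_Ioi hs hc β measurable_signChar norm_signChar_le_one]
  have h := integral_gaussian_mul_sin_Ioi hs hc β
  have h2 := congrArg (fun z => -2 * Complex.I * z) h
  simp only [← integral_const_mul] at h2
  refine Eq.trans ?_ (h2.trans (by ring))
  refine setIntegral_congr_fun measurableSet_Ioi fun t ht => ?_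
  simp only [signChar_of_pos (show 0 < t from ht),
    signChar_of_neg (show -t < 0 from neg_lt_zero.2 ht)]
  rw [Complex.sin]
  linear_combination ((t : ℂ) ^ (s - 1) * Complex.exp (-(c * (t : ℂ) ^ 2)) *
    (Complex.exp (-(β * t) * Complex.I) - Complex.exp ((β * t) * Complex.I))) * Complex.I_sq

/-- Continuity at `c₀` of the closed form of the regularised Mellin transforms. -/
theorem tendsto_cpow_mul_oneFOne {c₀ : ℂ} (hc₀ : c₀ ∈ Complex.slitPlane) {w v : ℂ}
    (hw : 0 < w.re) (hv : 0 < v.re) (β : ℝ) :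
    Tendsto (fun ε : ℝ => Complex.Gamma w * (1 / (c₀ + ε)) ^ w *
        oneFOne w v (-(β : ℂ) ^ 2 / (4 * (c₀ + ε)))) (𝓝[>] 0)
      (𝓝 (Complex.Gamma w * (1 / c₀) ^ w * oneFOne w v (-(β : ℂ) ^ 2 / (4 * c₀)))) := by
  have h0 : c₀ ≠ 0 := Complex.slitPlane_ne_zero hc₀
  have hadd : Tendsto (fun ε : ℝ => c₀ + (ε : ℂ)) (𝓝[>] 0) (𝓝 c₀) := by
    have : Continuous fun ε : ℝ => c₀ + (ε : ℂ) := by fun_prop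
    simpa using (this.tendsto 0).mono_left nhdsWithin_le_nhds
  have hinv : 1 / c₀ ∈ Complex.slitPlane := by
    rw [one_div, Complex.mem_slitPlane_iff_arg, Complex.arg_inv,
      if_neg (Complex.slitPlane_arg_ne_pi hc₀)]
    exact ⟨by linarith [Complex.neg_pi_lt_arg c₀], inv_ne_zero h0⟩
  have h1 : Tendsto (fun ε : ℝ => 1 / (c₀ + (ε : ℂ))) (𝓝[>] 0) (𝓝 (1 / c₀)) :=
    tendsto_const_nhds.div hadd h0
  have h2 : Tendsto (fun ε : ℝ => -(β : ℂ) ^ 2 / (4 * (c₀ + (ε : ℂ)))) (𝓝[>] 0)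
      (𝓝 (-(β : ℂ) ^ 2 / (4 * c₀))) :=
    tendsto_const_nhds.div (hadd.const_mul 4) (mul_ne_zero (by norm_num) h0)
  exact ((h1.cpow tendsto_const_nhds hinv).const_mul _).mul
    (((continuous_oneFOne hw hv).tendsto _).comp h2)

/-- With principal branches: `1 / (πai)` has argument `-π/2`. -/
theorem one_div_pi_mul_I_cpow {a : ℝ} (ha : 0 < a) (w : ℂ) :
    (1 / (Real.pi * a * Complex.I : ℂ)) ^ (w / 2) =
      Complex.exp (-w * (Real.pi * Complex.I / 4)) / ((Real.sqrt a : ℝ) : ℂ) ^ w /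
        (Real.pi : ℂ) ^ (w / 2) := by
  have hpi := Real.pi_pos
  have hsq : 0 < Real.sqrt a := Real.sqrt_pos.2 ha
  have hpa : 0 < (Real.pi * a)⁻¹ := by positivity
  have e1 : (1 / (Real.pi * a * Complex.I : ℂ)) = (((Real.pi * a)⁻¹ : ℝ) : ℂ) * (-Complex.I) := by
    push_cast
    rw [← Complex.inv_I]
    field_simp
  have hl : Complex.log (1 / (Real.pi * a * Complex.I : ℂ)) =
      -Real.log Real.pi - 2 * Real.log (Real.sqrt a) - Real.pi / 2 * Complex.I := by
    rw [e1, Complex.log_ofReal_mul hpa (neg_ne_zero.2 Complex.I_ne_zero), Complex.log_neg_I,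
      Real.log_inv, Real.log_mul hpi.ne' ha.ne', Real.log_sqrt ha.le]
    push_cast
    ring
  have hne : (1 / (Real.pi * a * Complex.I : ℂ)) ≠ 0 := by
    rw [e1]
    exact mul_ne_zero (Complex.ofReal_ne_zero.2 hpa.ne') (neg_ne_zero.2 Complex.I_ne_zero)
  rw [Complex.cpow_def_of_ne_zero hne, hl,
    Complex.cpow_def_of_ne_zero (Complex.ofReal_ne_zero.2 hsq.ne'),
    Complex.cpow_def_of_ne_zero (Complex.ofReal_ne_zero.2 hpi.ne'),
    ← Complex.ofReal_log hsq.le, ← Complex.ofReal_log hpi.le, ← Complex.exp_sub, ← Complex.exp_sub]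
  congr 1
  ring

theorem pi_mul_I_mem_slitPlane {a : ℝ} (ha : 0 < a) :
    (Real.pi * a * Complex.I : ℂ) ∈ Complex.slitPlane := by
  right
  simp [ha.ne', Real.pi_ne_zero]

theorem neg_sq_div_four_mul_pi_mul_I {a : ℝ} (ha : 0 < a) (b : ℝ) :
    -((2 * Real.pi * b : ℝ) : ℂ) ^ 2 / (4 * (Real.pi * a * Complex.I)) =
      Real.pi * Complex.I * (b : ℂ) ^ 2 / a := by
  have h1 : (Real.pi : ℂ) ≠ 0 := Complex.ofReal_ne_zero.2 Real.pi_ne_zero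
  have h2 : (a : ℂ) ≠ 0 := Complex.ofReal_ne_zero.2 ha.ne'
  have h3 := Complex.I_ne_zero
  rw [div_eq_div_iff (by simp [h1, h2]) h2]
  push_cast
  linear_combination (-4 * (Real.pi : ℂ) ^ 2 * b ^ 2 * a) * Complex.I_sq

theorem pi_mul_I_add_ofReal_re (a ε : ℝ) : ((Real.pi * a * Complex.I : ℂ) + ε).re = ε := by
  simp

theorem isWeakMellin_secondDegreeChar_trivialChar {a : ℝ} (ha : 0 < a) (b : ℝ) {s : ℂ}
    (hs : 0 < s.re) :
    IsWeakMellin (secondDegreeChar a b) s trivialChar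
      (Complex.exp (-s * (Real.pi * Complex.I / 4)) / ((Real.sqrt a : ℝ) : ℂ) ^ s
        * (Complex.Gamma (s / 2) / (Real.pi : ℂ) ^ (s / 2))
        * oneFOne (s / 2) (1 / 2) (Real.pi * Complex.I * (b : ℂ) ^ 2 / a)) := by
  have hslit := pi_mul_I_mem_slitPlane ha
  have h := isWeakMellin_gaussChar_of_tendsto (by simp) (Complex.slitPlane_ne_zero hslit) hs
    (2 * Real.pi * b) measurable_trivialChar norm_trivialChar_le_one
    (fun x y => by simp [trivialChar])
    ((tendsto_cpow_mul_oneFOne hslit (w := s / 2) (v := 1 / 2) (by simpa using hs) (by norm_num)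
      (2 * Real.pi * b)).congr' (by
        filter_upwards [self_mem_nhdsWithin] with ε hε
        exact (mellinReal_gaussChar_trivialChar hs
          ((pi_mul_I_add_ofReal_re a ε).symm ▸ hε) _).symm))
  rw [one_div_pi_mul_I_cpow ha, neg_sq_div_four_mul_pi_mul_I ha] at h
  rw [secondDegreeChar_eq_gaussChar]
  convert! h using 1
  ring

theorem isWeakMellin_secondDegreeChar_signChar {a : ℝ} (ha : 0 < a) (b : ℝ) {s : ℂ}
    (hs : 0 < s.re) :
    IsWeakMellin (secondDegreeChar a b) s signChar
      (-2 * Real.pi * Complex.I * b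
        * (Complex.exp (-(s + 1) * (Real.pi * Complex.I / 4))
            / ((Real.sqrt a : ℝ) : ℂ) ^ (s + 1))
        * (Complex.Gamma ((s + 1) / 2) / (Real.pi : ℂ) ^ ((s + 1) / 2))
        * oneFOne ((s + 1) / 2) (3 / 2) (Real.pi * Complex.I * (b : ℂ) ^ 2 / a)) := by
  have hslit := pi_mul_I_mem_slitPlane ha
  have hs1 : 0 < ((s + 1) / 2).re := by
    simp
    linarith
  have h := isWeakMellin_gaussChar_of_tendsto (by simp) (Complex.slitPlane_ne_zero hslit) hs
    (2 * Real.pi * b) measurable_signChar norm_signChar_le_one signChar_mul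
    (((tendsto_cpow_mul_oneFOne hslit (w := (s + 1) / 2) (v := 3 / 2) hs1 (by norm_num)
      (2 * Real.pi * b)).const_mul (-Complex.I * (2 * Real.pi * b : ℝ))).congr' (by
        filter_upwards [self_mem_nhdsWithin] with ε hε
        exact (mellinReal_gaussChar_signChar hs
          ((pi_mul_I_add_ofReal_re a ε).symm ▸ hε) _).symm))
  rw [one_div_pi_mul_I_cpow ha, neg_sq_div_four_mul_pi_mul_I ha] at h
  rw [secondDegreeChar_eq_gaussChar]
  convert! h using 1
  push_cast
  ring

end WeakMellin

theorem mainTheorem6 (a b : ℝ) (ha : 0 < a) (s : ℂ) (hs : 0 < s.re) :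
    (∀ M : ℂ,
      WeakMellin.IsWeakMellin (WeakMellin.secondDegreeChar a b) s WeakMellin.trivialChar M ↔
        M = Complex.exp (-s * (Real.pi * Complex.I / 4)) / ((Real.sqrt a : ℝ) : ℂ) ^ s
          * (Complex.Gamma (s / 2) / (Real.pi : ℂ) ^ (s / 2))
          * WeakMellin.oneFOne (s / 2) (1 / 2) (Real.pi * Complex.I * (b : ℂ) ^ 2 / a)) ∧
    (∀ M : ℂ,
      WeakMellin.IsWeakMellin (WeakMellin.secondDegreeChar a b) s WeakMellin.signChar M ↔
        M = -2 * Real.pi * Complex.I * b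
          * (Complex.exp (-(s + 1) * (Real.pi * Complex.I / 4))
              / ((Real.sqrt a : ℝ) : ℂ) ^ (s + 1))
          * (Complex.Gamma ((s + 1) / 2) / (Real.pi : ℂ) ^ ((s + 1) / 2))
          * WeakMellin.oneFOne ((s + 1) / 2) (3 / 2)
              (Real.pi * Complex.I * (b : ℂ) ^ 2 / a)) := by
  constructor
  · have h := WeakMellin.isWeakMellin_secondDegreeChar_trivialChar ha b hs
    exact fun M => ⟨fun hM => hM.unique (fun _ _ => rfl) h, fun hM => hM ▸ h⟩
  · have h := WeakMellin.isWeakMellin_secondDegreeChar_signChar ha b hs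
    exact fun M =>
      ⟨fun hM => hM.unique (fun _ hx => WeakMellin.signChar_of_pos hx) h, fun hM => hM ▸ h⟩
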